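/- Let $P$ be a Markov transition kernel on a measurable space $\mathsf X$. Assume that there are a measurable set $C$, a constant $\epsilon\in(0,1]$ and a probability measure $\nu$ with $P(x,\cdot)\ge\epsilon\,\nu(\cdot)$ for all $x\in C$. For $x\in C$ let $Q(x,\cdot)=(1-\epsilon)^{-1}(P(x,\cdot)-\epsilon\nu)$ if $\epsilon<1$ and $Q(x,\cdot)=\nu$ if $\epsilon=1$. Let $\check P$ be any Markov kernel on $\mathsf X\times\mathsf X$ such that $\check P(x,x';\cdot)$ has marginals $P(x,\cdot)$ and $P(x',\cdot)$ when $(x,x')\notin C\times C$, and marginals $Q(x,\cdot)$ and $Q(x',\cdot)$ when $(x,x')\in C\times C$. Let $\check{\mathbb E}_{x,x'}$ be the expectation for the Markov chain $(X_k,X'_k)_{k\ge0}$ with kernel $\check P$ started at $(x,x')$, and put $\sigma=\inf\{n\ge0:(X_n,X'_n)\in C\times C\}$, $\tau=\inf\{n\ge1:(X_n,X'_n)\in C\times C\}$ (with $\inf\emptyset=\infty$). Write $\|\mu-\mu'\|_{\mathrm{TV}}=\sup_{A}|\mu(A)-\mu'(A)|=\tfrac12\sup_{|g|\le1}|\mu(g)-\mu'(g)|$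 for probability measures $\mu,\mu'$ (supremum over measurable sets, respectively functions), and $\|\mu-\mu'\|_f=\sup_{|g|\le f}|\mu(g)-\mu'(g)|$, the supremum being over measurable $g$ integrable for both measures. All quantities below take values in $[0,\infty]$, with $0\cdot\infty=0$, and a supremum over an empty set is $0$. (1) Let $r:\mathbb N\to[0,\infty)$ be a subgeometric sequence: $r$ is nondecreasing, $r(n)>0$ for $n\ge1$, and $\log r(n)/n$, $n\ge1$, is nonincreasing with limit $0$. Then for all $\delta>0$ and all $x,x'\in\mathsf X$, $$\sum_{n=1}^\infty r(n)\,\|P^n(x,\cdot)-P^n(x',\cdot)\|_{\mathrm{TV}}\le(1+\delta)\,\check{\mathbb E}_{x,x'}\Big[\sum_{k=0}^{\sigma}r(k)\Big]+\frac{1-\epsilon}{\epsilon}M,$$ where $R(n)=\sum_{k=0}^{n-1}r(k)$, $R^*=\sup_{(y,y')\in C\times C}\check{\mathbb E}_{y,y'}\big[\sum_{k=1}^{\tau}r(k)\big]$ and $M=(1+\delta)\sup_{n\ge1}\big\{R^*r(n-1)-\epsilon(1-\epsilon)\delta R(n)/(1+\delta)\big\}_+$. (2) Let $W:\mathsf X\times\mathsf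 X\to[1,\infty)$ be measurable and let $f\ge0$ be a function on $\mathsf X$ with $f(x)+f(x')\le W(x,x')$ for all $x,x'$. Then for all $x,x'\in\mathsf X$, $$\sum_{n=1}^\infty\|P^n(x,\cdot)-P^n(x',\cdot)\|_f\le\check{\mathbb E}_{x,x'}\Big[\sum_{k=0}^{\sigma}W(X_k,X'_k)\Big]+\frac{1-\epsilon}{\epsilon}W^*,$$ where $W^*=\sup_{(y,y')\in C\times C}\check{\mathbb E}_{y,y'}\big[\sum_{k=1}^{\tau}W(X_k,X'_k)\big]$. -/

import Mathlib

open MeasureTheory ProbabilityTheory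
open scoped ENNReal

noncomputable section

namespace SubgeometricCoupling

/-- Subgeometric rate sequences: nonnegative (positive from index `1` on), nondecreasing, and such
that `log r(n) / n` decreases to `0` along `n ≥ 1`. -/
structure IsSubgeometric (r : ℕ → ℝ) : Prop where
  nonneg_zero : 0 ≤ r 0
  pos : ∀ n, 1 ≤ n → 0 < r n
  mono : Monotone r
  log_div_antitone : AntitoneOn (fun n : ℕ => Real.log (r n) / n) (Set.Ici 1)
  log_div_tendsto : Filter.Tendsto (fun n : ℕ => Real.log (r n) / n) Filter.atTop (nhds 0)

variable {X : Type*} [MeasurableSpace X]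

/-- Total variation distance of two probability measures, `sup_A |μ(A) - μ'(A)|`. -/
def tvDist (μ μ' : Measure X) : ℝ≥0∞ :=
  ⨆ (A : Set X) (_ : MeasurableSet A), ENNReal.ofReal |μ.real A - μ'.real A|

/-- The `f`-norm `‖μ - μ'‖_f = sup_{|g| ≤ f} |μ(g) - μ'(g)|` of the difference of two probability
measures, over the measurable `g` whose integrals against both measures make sense. -/
def fDist (f : X → ℝ) (μ μ' : Measure X) : ℝ≥0∞ :=
  ⨆ (g : X → ℝ) (_ : Measurable g) (_ : ∀ x, |g x| ≤ f x)
    (_ : Integrable g μ) (_ : Integrable g μ'),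
    ENNReal.ofReal |∫ x, g x ∂μ - ∫ x, g x ∂μ'|

/-- One-step minorisation `P(x, ·) ≥ ε ν` for all `x` in the measurable set `C`. -/
structure Minorised (P : Kernel X X) (C : Set X) (ε : ℝ) (ν : Measure X) : Prop where
  measurableSet : MeasurableSet C
  pos : 0 < ε
  le_one : ε ≤ 1
  isProbabilityMeasure : IsProbabilityMeasure ν
  le : ∀ x ∈ C, ∀ A, MeasurableSet A → ENNReal.ofReal ε * ν A ≤ P x A

open scoped Classical in
/-- Residual kernel: `Q(x, A) = (P(x, A) - ε ν(A)) / (1 - ε)` if `ε < 1`, and `ν(A)` if `ε = 1`.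
It is only used for `x ∈ C`, where the subtraction is a genuine one by the minorisation. -/
def residualMass (P : Kernel X X) (ε : ℝ) (ν : Measure X) (x : X) (A : Set X) : ℝ≥0∞ :=
  if ε < 1 then (ENNReal.ofReal (1 - ε))⁻¹ * (P x A - ENNReal.ofReal ε * ν A) else ν A

open scoped Classical in
/-- The bivariate kernel `Pc` has marginals `P(x, ·)`, `P(x', ·)` off `C × C` and `Q(x, ·)`,
`Q(x', ·)` on `C × C`. -/
structure IsCouplingKernel (P : Kernel X X) (C : Set X) (ε : ℝ) (ν : Measure X)
    (Pc : Kernel (X × X) (X × X)) : Prop where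
  fst : ∀ x x' : X, ∀ A : Set X, MeasurableSet A →
    Pc (x, x') (A ×ˢ Set.univ) =
      if (x, x') ∈ C ×ˢ C then residualMass P ε ν x A else P x A
  snd : ∀ x x' : X, ∀ A : Set X, MeasurableSet A →
    Pc (x, x') (Set.univ ×ˢ A) =
      if (x, x') ∈ C ×ˢ C then residualMass P ε ν x' A else P x' A

/-- Law, on the canonical space of trajectories, of the Markov chain with transition kernel `K`
started at `s`. -/
def chainLaw {S : Type*} [MeasurableSpace S] (K : Kernel S S) [IsMarkovKernel K] (s : S) :
    Measure (ℕ → S) :=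
  Kernel.traj (X := fun _ => S)
    (fun n : ℕ => K.comap (fun h : (i : Finset.Iic n) → S => h ⟨n, Finset.mem_Iic.2 le_rfl⟩)
      (measurable_pi_apply _)) 0 (fun _ => s)

/-- Hitting time `inf {n ≥ 0 : ω n ∈ D}` (with value `⊤` if `D` is never visited). -/
def hitTime {S : Type*} (D : Set S) (ω : ℕ → S) : WithTop ℕ :=
  hittingAfter (fun n (w : ℕ → S) => w n) D 0 ω

/-- Return time `inf {n ≥ 1 : ω n ∈ D}` (with value `⊤` if there is no such `n`). -/
def returnTime {S : Type*} (D : Set S) (ω : ℕ → S) : WithTop ℕ :=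
  hittingAfter (fun n (w : ℕ → S) => w n) D 1 ω

open scoped Classical in
/-- `E_s [∑_{k=0}^{σ} u(k, Y_k)]`, for `σ` the hitting time of `D` by the chain `(Y_k)`. -/
def expSumHit {S : Type*} [MeasurableSpace S] (K : Kernel S S) [IsMarkovKernel K] (D : Set S)
    (u : ℕ → S → ℝ) (s : S) : ℝ≥0∞ :=
  ∫⁻ ω, ∑' k : ℕ, (if (k : WithTop ℕ) ≤ hitTime D ω then ENNReal.ofReal (u k (ω k)) else 0)
    ∂(chainLaw K s)

open scoped Classical in
/-- `E_s [∑_{k=1}^{τ} u(k, Y_k)]`, for `τ` the return time of the chain `(Y_k)` to `D`. -/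
def expSumReturn {S : Type*} [MeasurableSpace S] (K : Kernel S S) [IsMarkovKernel K] (D : Set S)
    (u : ℕ → S → ℝ) (s : S) : ℝ≥0∞ :=
  ∫⁻ ω, ∑' k : ℕ, (if 1 ≤ k ∧ (k : WithTop ℕ) ≤ returnTime D ω
    then ENNReal.ofReal (u k (ω k)) else 0) ∂(chainLaw K s)

/-- `sup_{y ∈ D} E_y [∑_{k=1}^{τ} u(k, Y_k)]`. -/
def supReturn {S : Type*} [MeasurableSpace S] (K : Kernel S S) [IsMarkovKernel K] (D : Set S)
    (u : ℕ → S → ℝ) : ℝ≥0∞ :=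
  ⨆ y ∈ D, expSumReturn K D u y

/-- `M = (1 + δ) sup_{n ≥ 1} {R* r(n - 1) - ε (1 - ε) δ R(n) / (1 + δ)}₊`, where
`R(n) = ∑_{k < n} r(k)`, written with `n + 1` in place of `n`. The subtraction in `ℝ≥0∞` is
truncated at `0`, which is the positive part. -/
def rateConst (r : ℕ → ℝ) (ε δ : ℝ) (Rstar : ℝ≥0∞) : ℝ≥0∞ :=
  ENNReal.ofReal (1 + δ) * ⨆ n : ℕ,
    (Rstar * ENNReal.ofReal (r n)
      - ENNReal.ofReal (ε * (1 - ε) * δ * (∑ k ∈ Finset.range (n + 1), r k) / (1 + δ)))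

end SubgeometricCoupling

end

/-! Put D = C × C and let T be one step of the coupled chain, weighted by 1 - ε on D and by 1 off D:
`step (killWeight D (1 - ε)) Pc`. On C, P(x, ·) = (1 - ε) Q(x, ·) + ε ν, and the ν parts cancel in a
difference. Hence |Pg(x) - Pg(x')| is at most T applied to |g(y) - g(y')|, and by iteration the
distances at time n are at most Tⁿ1 and TⁿW (`tvDist_pow_le`, `fDist_pow_le`).

It remains to bound the potential of T. `sum_step_le_hitPotential_add` dominates it by a
time-dependent supersolution: the potential up to the hitting time of D, plus a function c(n). Off D
the hitting potential solves its own one-step equation. On D the factor 1 - ε must pay for one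
excursion back to D.

For W, a constant c suffices: (1 - ε) W* / ε is the fixed point of c ↦ (1 - ε)(c + W*). For a rate
r, an excursion begun at time n ≥ 1 costs up to r(n) R*, since r(n + k) ≤ r(n) r(k). This may grow
with n, so c(n) contains β R(n + 1). That growth is paid for by inflating r to (1 + β) r in the
hitting potential, and M absorbs the rest. Submultiplicativity may fail at n = 0, so the first step
is treated apart (`drift_ineq_start`). -/

namespace SubgeometricCoupling

/-! ### Weighted steps of a kernel, and hitting sums under the law of the chain. -/

section Step

variable {S : Type*}

section Weight

/-- Indicator of the complement of `D`, as a weight. -/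
noncomputable def offWeight (D : Set S) : S → ℝ≥0∞ := Dᶜ.indicator 1

lemma offWeight_of_mem {D : Set S} {z : S} (hz : z ∈ D) : offWeight D z = 0 := by
  simp [offWeight, hz]

lemma offWeight_of_notMem {D : Set S} {z : S} (hz : z ∉ D) : offWeight D z = 1 := by
  simp [offWeight, hz]

lemma prod_offWeight_of_forall {D : Set S} {ω : ℕ → S} {m k : ℕ}
    (h : ∀ i, m ≤ i → i < k → ω i ∉ D) : ∏ i ∈ Finset.Ico m k, offWeight D (ω i) = 1 :=
  Finset.prod_eq_one fun i hi ↦ offWeight_of_notMem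
    (h i (Finset.mem_Ico.1 hi).1 (Finset.mem_Ico.1 hi).2)

/-- The time k is at most the first visit after m exactly when no visit occurs in [m, k), so the
stopping condition becomes a product of one-time weights. -/
lemma ite_le_hittingAfter {D : Set S} (ω : ℕ → S) (m k : ℕ) (a : ℝ≥0∞)
    [Decidable ((k : WithTop ℕ) ≤ hittingAfter (fun n (w : ℕ → S) ↦ w n) D m ω)] :
    (if (k : WithTop ℕ) ≤ hittingAfter (fun n (w : ℕ → S) ↦ w n) D m ω then a else 0)
      = (∏ i ∈ Finset.Ico m k, offWeight D (ω i)) * a := by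
  split_ifs with h
  · rw [prod_offWeight_of_forall, one_mul]
    intro i hmi hik
    exact notMem_of_lt_hittingAfter (u := fun n (w : ℕ → S) ↦ w n)
      (lt_of_lt_of_le (WithTop.coe_lt_coe.2 hik) h) hmi
  · have hex : ∃ i, m ≤ i ∧ i < k ∧ ω i ∈ D := by
      by_contra! hcon
      apply h
      rw [hittingAfter]
      split_ifs with hj
      · exact WithTop.coe_le_coe.2 (le_csInf hj fun i hi ↦ not_lt.1 fun hik ↦ hcon i hi.1 hik hi.2)
      · exact le_top
    obtain ⟨i, hmi, hik, hi⟩ := hex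
    rw [Finset.prod_eq_zero (f := fun i ↦ offWeight D (ω i)) (Finset.mem_Ico.2 ⟨hmi, hik⟩)
      (offWeight_of_mem hi), zero_mul]

lemma ite_le_hitTime {D : Set S} (ω : ℕ → S) (k : ℕ) (a : ℝ≥0∞)
    [inst : Decidable ((k : WithTop ℕ) ≤ hitTime D ω)] :
    (if (k : WithTop ℕ) ≤ hitTime D ω then a else 0)
      = (∏ i ∈ Finset.Ico 0 k, offWeight D (ω i)) * a :=
  @ite_le_hittingAfter S D ω 0 k a inst

lemma ite_le_returnTime {D : Set S} (ω : ℕ → S) (k : ℕ) (a : ℝ≥0∞)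
    [inst : Decidable ((k : WithTop ℕ) ≤ returnTime D ω)] :
    (if (k : WithTop ℕ) ≤ returnTime D ω then a else 0)
      = (∏ i ∈ Finset.Ico 1 k, offWeight D (ω i)) * a :=
  @ite_le_hittingAfter S D ω 1 k a inst

end Weight

variable [MeasurableSpace S]

/-- One step of the kernel `K`, weighted by a function `w` of the starting point. -/
noncomputable def step (w : S → ℝ≥0∞) (K : Kernel S S) (f : S → ℝ≥0∞) (z : S) : ℝ≥0∞ :=
  w z * ∫⁻ y, f y ∂K z

lemma measurable_step {w : S → ℝ≥0∞} (hw : Measurable w) (K : Kernel S S) {f : S → ℝ≥0∞}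
    (hf : Measurable f) : Measurable (step w K f) :=
  hw.mul hf.lintegral_kernel

lemma measurable_step_iterate {w : S → ℝ≥0∞} (hw : Measurable w) (K : Kernel S S) {f : S → ℝ≥0∞}
    (hf : Measurable f) (n : ℕ) : Measurable ((step w K)^[n] f) := by
  induction n with
  | zero => exact hf
  | succ n ih => rw [Function.iterate_succ_apply']; exact measurable_step hw K ih

lemma step_mono (w : S → ℝ≥0∞) (K : Kernel S S) : Monotone (step w K) :=
  fun _ _ h _ ↦ mul_le_mul_right (lintegral_mono h) _

lemma measurable_offWeight {D : Set S} (hD : MeasurableSet D) : Measurable (offWeight D) :=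
  measurable_one.indicator hD.compl

/-- The expectation of `∑_{k = 1}^σ u (n + k) (Y k)`, with `σ` the hitting time of `D`. -/
noncomputable def hitPotential (D : Set S) (K : Kernel S S) (u : ℕ → S → ℝ≥0∞) (n : ℕ) (z : S) :
    ℝ≥0∞ :=
  ∑' k : ℕ, (step (offWeight D) K)^[k + 1] (u (n + (k + 1))) z

variable (K : Kernel S S)

/-- First-step analysis. On D both sides vanish, because the weight kills the starting point. -/
lemma hitPotential_eq_step {D : Set S} (hD : MeasurableSet D) {u : ℕ → S → ℝ≥0∞}
    (hu : ∀ n, Measurable (u n)) (n : ℕ) :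
    hitPotential D K u n
      = step (offWeight D) K (fun y ↦ u (n + 1) y + hitPotential D K u (n + 1) y) := by
  ext z
  have h1 : ∀ y, u (n + 1) y + hitPotential D K u (n + 1) y
      = ∑' k : ℕ, (step (offWeight D) K)^[k] (u (n + (k + 1))) y := by
    intro y
    rw [tsum_eq_zero_add' ENNReal.summable]
    simp [hitPotential, add_assoc, add_comm 1]
  simp_rw [h1, step]
  rw [lintegral_tsum fun k ↦
    (measurable_step_iterate (measurable_offWeight hD) K (hu _) k).aemeasurable,
    ← ENNReal.tsum_mul_left]
  simp_rw [hitPotential, Function.iterate_succ_apply', step]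

variable [IsMarkovKernel K]

/-- The Markov property at time k: the joint law of the path up to k and of the next state is the
path law composed with K. -/
lemma lintegral_chainLaw_succ (s : S) (k : ℕ) {F : ((i : Finset.Iic k) → S) → ℝ≥0∞}
    (hF : Measurable F) {g : S → ℝ≥0∞} (hg : Measurable g) :
    ∫⁻ ω, F (Preorder.frestrictLe k ω) * g (ω (k + 1)) ∂chainLaw K s
      = ∫⁻ ω, F (Preorder.frestrictLe k ω) * ∫⁻ y, g y ∂K (ω k) ∂chainLaw K s := by
  have h1 : Measurable fun p : ((i : Finset.Iic k) → S) × S ↦ F p.1 * g p.2 := by fun_prop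
  let κ : (n : ℕ) → Kernel ((i : Finset.Iic n) → S) S := fun n : ℕ =>
    K.comap (fun h : (i : Finset.Iic n) → S => h ⟨n, Finset.mem_Iic.2 le_rfl⟩)
      (measurable_pi_apply _)
  have h2 := Kernel.partialTraj_compProd_eq_map_traj (X := fun _ => S) (κ := κ) (zero_le (a := k))
    (x₀ := fun _ ↦ s)
  have h3 := Kernel.traj_map_frestrictLe_apply (X := fun _ => S) (κ := κ) 0 k (fun _ ↦ s)
  have hK : chainLaw K s = Kernel.traj (X := fun _ => S) (κ := κ) 0 (fun _ ↦ s) := rfl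
  have h4 : ∫⁻ ω, F (Preorder.frestrictLe k ω) * g (ω (k + 1)) ∂chainLaw K s
      = ∫⁻ p, F p.1 * g p.2 ∂((chainLaw K s).map fun x ↦ (Preorder.frestrictLe k x, x (k + 1))) := by
    rw [lintegral_map h1 (by fun_prop)]
  rw [h4, hK, ← h2, Measure.lintegral_compProd h1, ← h3, lintegral_map]
  · refine lintegral_congr fun ω ↦ ?_
    dsimp only
    rw [lintegral_const_mul _ hg]
    rfl
  · exact h1.lintegral_kernel_prod_right'
  · fun_prop

lemma lintegral_chainLaw_zero (s : S) {g : S → ℝ≥0∞} (hg : Measurable g) :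
    ∫⁻ ω, g (ω 0) ∂chainLaw K s = g s := by
  let κ : (n : ℕ) → Kernel ((i : Finset.Iic n) → S) S := fun n : ℕ =>
    K.comap (fun h : (i : Finset.Iic n) → S => h ⟨n, Finset.mem_Iic.2 le_rfl⟩)
      (measurable_pi_apply _)
  have h3 := Kernel.traj_map_frestrictLe_apply (X := fun _ => S) (κ := κ) 0 0 (fun _ ↦ s)
  have hm : Measurable fun h : (i : Finset.Iic 0) → S ↦ g (h ⟨0, Finset.mem_Iic.2 le_rfl⟩) :=
    hg.comp (measurable_pi_apply _)
  have h4 : ∫⁻ ω, g (ω 0) ∂chainLaw K s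
      = ∫⁻ h, g (h ⟨0, Finset.mem_Iic.2 le_rfl⟩)
        ∂((chainLaw K s).map (Preorder.frestrictLe (π := fun _ ↦ S) 0)) := by
    rw [lintegral_map hm (by fun_prop)]
    rfl
  have hK : chainLaw K s = Kernel.traj (X := fun _ => S) (κ := κ) 0 (fun _ ↦ s) := rfl
  rw [h4, hK, h3, Kernel.partialTraj_self, Kernel.id_apply, lintegral_dirac' _ hm]

lemma lintegral_prod_offWeight_succ (s : S) {D : Set S} (hD : MeasurableSet D) {k : ℕ}
    {I : Finset ℕ} (hI : ∀ i ∈ I, i ≤ k) {g : S → ℝ≥0∞} (hg : Measurable g) :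
    ∫⁻ ω, (∏ i ∈ I, offWeight D (ω i)) * g (ω (k + 1)) ∂chainLaw K s
      = ∫⁻ ω, (∏ i ∈ I, offWeight D (ω i)) * ∫⁻ y, g y ∂K (ω k) ∂chainLaw K s := by
  have hw := measurable_offWeight hD
  let F : ((i : Finset.Iic k) → S) → ℝ≥0∞ := fun h ↦
    ∏ i ∈ I.attach, offWeight D (h ⟨i, Finset.mem_Iic.2 (hI i i.2)⟩)
  have hF : Measurable F :=
    Finset.measurable_fun_prod _ fun i _ ↦ hw.comp (measurable_pi_apply _)
  have hFe : ∀ ω : ℕ → S, ∏ i ∈ I, offWeight D (ω i)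
      = F (Preorder.frestrictLe (π := fun _ ↦ S) k ω) := fun ω ↦
    (Finset.prod_attach I fun i ↦ offWeight D (ω i)).symm
  simp_rw [hFe]
  exact lintegral_chainLaw_succ K s k hF hg

/-- The last step is peeled off: integrating out the state at time k + 1 and absorbing the weight at
time k turns `g` into `step (offWeight D) K g`. -/
lemma lintegral_prod_offWeight_hit (s : S) {D : Set S} (hD : MeasurableSet D) (k : ℕ)
    {g : S → ℝ≥0∞} (hg : Measurable g) :
    ∫⁻ ω, (∏ i ∈ Finset.Ico 0 k, offWeight D (ω i)) * g (ω k) ∂chainLaw K s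
      = (step (offWeight D) K)^[k] g s := by
  induction k generalizing g with
  | zero => simpa using lintegral_chainLaw_zero K s hg
  | succ k ih =>
    rw [Function.iterate_succ_apply, ← ih (measurable_step (measurable_offWeight hD) K hg),
      lintegral_prod_offWeight_succ K s hD (fun i hi ↦ by simp at hi; lia) hg]
    simp_rw [Finset.prod_Ico_succ_top k.zero_le, step, ← mul_assoc]

/-- The weights begin at time 1, so the starting point carries none and the first step is a bare
integral against `K s`. -/
lemma lintegral_prod_offWeight_return (s : S) {D : Set S} (hD : MeasurableSet D) (k : ℕ)
    {g : S → ℝ≥0∞} (hg : Measurable g) :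
    ∫⁻ ω, (∏ i ∈ Finset.Ico 1 (k + 1), offWeight D (ω i)) * g (ω (k + 1)) ∂chainLaw K s
      = ∫⁻ y, (step (offWeight D) K)^[k] g y ∂K s := by
  induction k generalizing g with
  | zero =>
    rw [lintegral_prod_offWeight_succ K s hD (by simp) hg]
    simpa using lintegral_chainLaw_zero K s hg.lintegral_kernel
  | succ k ih =>
    rw [Function.iterate_succ_apply, ← ih (measurable_step (measurable_offWeight hD) K hg),
      lintegral_prod_offWeight_succ K s hD (fun i hi ↦ by simp at hi; lia) hg]
    simp_rw [Finset.prod_Ico_succ_top (Nat.le_add_left 1 k), step, ← mul_assoc]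

lemma measurable_prod_offWeight_mul {D : Set S} (hD : MeasurableSet D) (I : Finset ℕ) (k : ℕ)
    {g : S → ℝ≥0∞} (hg : Measurable g) :
    Measurable fun ω : ℕ → S ↦ (∏ i ∈ I, offWeight D (ω i)) * g (ω k) :=
  (Finset.measurable_fun_prod _ fun i _ ↦
    (measurable_offWeight hD).comp (measurable_pi_apply i)).mul (hg.comp (measurable_pi_apply k))

lemma expSumHit_eq (s : S) {D : Set S} (hD : MeasurableSet D) {u : ℕ → S → ℝ}
    (hu : ∀ n, Measurable (u n)) :
    expSumHit K D u s
      = ENNReal.ofReal (u 0 s) + hitPotential D K (fun n z ↦ ENNReal.ofReal (u n z)) 0 s := by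
  have hu' : ∀ n, Measurable fun z ↦ ENNReal.ofReal (u n z) := fun n ↦ (hu n).ennreal_ofReal
  simp_rw [expSumHit, ite_le_hitTime]
  rw [lintegral_tsum fun k ↦ (measurable_prod_offWeight_mul hD _ k (hu' k)).aemeasurable]
  simp_rw [fun k ↦ lintegral_prod_offWeight_hit K s hD k (hu' k)]
  rw [tsum_eq_zero_add' ENNReal.summable]
  simp [hitPotential]

lemma expSumReturn_eq (s : S) {D : Set S} (hD : MeasurableSet D) {u : ℕ → S → ℝ}
    (hu : ∀ n, Measurable (u n)) :
    expSumReturn K D u s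
      = ∫⁻ y, (ENNReal.ofReal (u 1 y)
          + hitPotential D K (fun n z ↦ ENNReal.ofReal (u n z)) 1 y) ∂K s := by
  have hu' : ∀ n, Measurable fun z ↦ ENNReal.ofReal (u n z) := fun n ↦ (hu n).ennreal_ofReal
  have h1 : ∀ y, ENNReal.ofReal (u 1 y)
      + hitPotential D K (fun n z ↦ ENNReal.ofReal (u n z)) 1 y
      = ∑' k : ℕ, (step (offWeight D) K)^[k] (fun z ↦ ENNReal.ofReal (u (k + 1) z)) y := by
    intro y
    rw [tsum_eq_zero_add' ENNReal.summable]
    simp [hitPotential, add_comm 1]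
  simp_rw [h1]
  rw [lintegral_tsum fun k ↦
    (measurable_step_iterate (measurable_offWeight hD) K (hu' _) k).aemeasurable]
  simp_rw [← fun k ↦ lintegral_prod_offWeight_return K s hD k (hu' (k + 1)),
    expSumReturn, ite_and, ite_le_returnTime]
  rw [lintegral_tsum, tsum_eq_zero_add' ENNReal.summable]
  · simp
  · intro k
    split_ifs
    · exact (measurable_prod_offWeight_mul hD _ k (hu' k)).aemeasurable
    · exact aemeasurable_const

end Step

/-! ### Supersolutions for the potential of the killed kernel. -/

section Potential

variable {S : Type*}

/-- The weight equal to `a` on `D` and to `1` off `D`. -/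
noncomputable def killWeight (D : Set S) (a : ℝ≥0∞) : S → ℝ≥0∞ :=
  fun z ↦ D.indicator (fun _ ↦ a) z + offWeight D z

lemma killWeight_of_mem {D : Set S} {a : ℝ≥0∞} {z : S} (hz : z ∈ D) : killWeight D a z = a := by
  simp [killWeight, hz, offWeight_of_mem]

lemma killWeight_of_notMem {D : Set S} {a : ℝ≥0∞} {z : S} (hz : z ∉ D) :
    killWeight D a z = 1 := by
  simp [killWeight, hz, offWeight_of_notMem]

variable [MeasurableSpace S]

lemma measurable_killWeight {D : Set S} (hD : MeasurableSet D) (a : ℝ≥0∞) :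
    Measurable (killWeight D a) :=
  (measurable_const.indicator hD).add (measurable_offWeight hD)

lemma sum_step_succ {w : S → ℝ≥0∞} (hw : Measurable w) (K : Kernel S S) {u : ℕ → S → ℝ≥0∞}
    (hu : ∀ n, Measurable (u n)) (N n : ℕ) (z : S) :
    ∑ k ∈ Finset.range (N + 1), (step w K)^[k + 1] (u (n + (k + 1))) z
      = w z * ∫⁻ y, (u (n + 1) y
        + ∑ k ∈ Finset.range N, (step w K)^[k + 1] (u (n + 1 + (k + 1))) y) ∂K z := by
  have h1 : ∀ y, u (n + 1) y
      + ∑ k ∈ Finset.range N, (step w K)^[k + 1] (u (n + 1 + (k + 1))) y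
      = ∑ k ∈ Finset.range (N + 1), (step w K)^[k] (u (n + (k + 1))) y := by
    intro y
    rw [Finset.sum_range_succ']
    simp [add_assoc, add_comm 1, add_comm (u (n + 1) y)]
  simp_rw [h1]
  rw [lintegral_finsetSum _ fun k _ ↦ measurable_step_iterate hw K (hu _) k, Finset.mul_sum]
  simp_rw [Function.iterate_succ_apply', step]

variable {D : Set S} {K : Kernel S S} [IsMarkovKernel K] {a : ℝ≥0∞} {u u' : ℕ → S → ℝ≥0∞}
  {c : ℕ → ℝ≥0∞}

/-- The inductive step of the drift bound, valid on and off D. It is isolated because the rate bound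
also applies it alone, to the step from time 0 to time 1. -/
lemma sum_step_succ_le (hD : MeasurableSet D) (hu : ∀ n, Measurable (u n)) {N n : ℕ}
    (hoff : ∀ y, u (n + 1) y + c (n + 1) ≤ u' (n + 1) y + c n)
    (hN : ∀ y, ∑ k ∈ Finset.range N, (step (killWeight D a) K)^[k + 1] (u (n + 1 + (k + 1))) y
      ≤ hitPotential D K u' (n + 1) y + c (n + 1)) (z : S) :
    ∑ k ∈ Finset.range (N + 1), (step (killWeight D a) K)^[k + 1] (u (n + (k + 1))) z
      ≤ killWeight D a z
        * (c n + ∫⁻ y, (u' (n + 1) y + hitPotential D K u' (n + 1) y) ∂K z) := by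
  rw [sum_step_succ (measurable_killWeight hD a) K hu]
  gcongr
  calc _ ≤ ∫⁻ y, (c n + (u' (n + 1) y + hitPotential D K u' (n + 1) y)) ∂K z := by
        refine lintegral_mono fun y ↦ ?_
        calc _ ≤ u (n + 1) y + (hitPotential D K u' (n + 1) y + c (n + 1)) := by gcongr; exact hN y
          _ = (u (n + 1) y + c (n + 1)) + hitPotential D K u' (n + 1) y := by ring
          _ ≤ (u' (n + 1) y + c n) + hitPotential D K u' (n + 1) y := add_le_add_left (hoff y) _
          _ = _ := by ring
    _ = _ := by rw [lintegral_add_left measurable_const]; simp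

/-- Drift bound for the potential of the killed kernel, by the potential up to the hitting time. -/
lemma sum_step_le_hitPotential_add (hD : MeasurableSet D) (hu : ∀ n, Measurable (u n))
    (hu' : ∀ n, Measurable (u' n)) {n₀ : ℕ}
    (hoff : ∀ n ≥ n₀, ∀ y, u (n + 1) y + c (n + 1) ≤ u' (n + 1) y + c n)
    (hon : ∀ n ≥ n₀, ∀ z ∈ D,
      a * (c n + ∫⁻ y, (u' (n + 1) y + hitPotential D K u' (n + 1) y) ∂K z) ≤ c n)
    (N : ℕ) : ∀ n ≥ n₀, ∀ z,
      ∑ k ∈ Finset.range N, (step (killWeight D a) K)^[k + 1] (u (n + (k + 1))) z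
        ≤ hitPotential D K u' n z + c n := by
  induction N with
  | zero => simp
  | succ N ih =>
    intro n hn z
    refine (sum_step_succ_le hD hu (hoff n hn) (ih (n + 1) (by lia)) z).trans ?_
    by_cases hz : z ∈ D
    · rw [killWeight_of_mem hz]
      exact (hon n hn z hz).trans le_add_self
    · rw [killWeight_of_notMem hz, congrFun (hitPotential_eq_step K hD hu' n) z, step,
        offWeight_of_notMem hz, one_mul, one_mul, add_comm]

end Potential

/-! ### Contraction of differences by the coupling. -/

section Coupling

variable {X : Type*} [MeasurableSpace X] {P : Kernel X X} [IsMarkovKernel P]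
  {C : Set X} {ε : ℝ} {ν : Measure X} {Pc : Kernel (X × X) (X × X)} [IsMarkovKernel Pc]

instance isMarkovKernel_pow (n : ℕ) : IsMarkovKernel (P ^ n) := by
  induction n with
  | zero => rw [pow_zero]; exact inferInstanceAs (IsMarkovKernel Kernel.id)
  | succ n ih => rw [pow_succ']; exact inferInstanceAs (IsMarkovKernel (P ∘ₖ (P ^ n)))

lemma integral_pow_succ (n : ℕ) (x : X) {g : X → ℝ} (hg : Measurable g) {b : ℝ}
    (hb : ∀ y, |g y| ≤ b) :
    ∫ y, g y ∂((P ^ (n + 1)) x) = ∫ y, ∫ z, g z ∂(P y) ∂((P ^ n) x) := by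
  have h : P ^ (n + 1) = P ∘ₖ (P ^ n) := pow_succ' P n
  have hi : Integrable g ((P ∘ₖ (P ^ n)) x) :=
    Integrable.of_bound hg.aestronglyMeasurable b (ae_of_all _ hb)
  rw [h, Kernel.integral_comp hi]

/-- The decomposition `P(x, ·) = (1 - ε) Q(x, ·) + ε ν` on `C`. -/
lemma Minorised.eq_add (hC : Minorised P C ε ν) {x : X} (hx : x ∈ C) {A : Set X}
    (hA : MeasurableSet A) :
    P x A = ENNReal.ofReal (1 - ε) * residualMass P ε ν x A + ENNReal.ofReal ε * ν A := by
  have := hC.isProbabilityMeasure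
  rw [residualMass]
  split_ifs with h
  · rw [← mul_assoc, ENNReal.mul_inv_cancel (by simpa using h) (by simp), one_mul,
      tsub_add_cancel_of_le (hC.le x hx A hA)]
  · have h1 : ε = 1 := le_antisymm hC.le_one (not_lt.1 h)
    subst h1
    -- For ε = 1 both measures are probabilities and one dominates the other; passing to complements
    -- reverses the inequality.
    have hle : ∀ B, MeasurableSet B → ν B ≤ P x B := fun B hB ↦ by simpa using hC.le x hx B hB
    have hge : P x A ≤ ν A := by
      have h2 := hle Aᶜ hA.compl
      rw [prob_compl_eq_one_sub hA, prob_compl_eq_one_sub hA] at h2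
      exact (ENNReal.sub_le_sub_iff_left prob_le_one (by simp)).1 h2
    simpa using le_antisymm hge (hle A hA)

/-- `residualMass` is only a set function. Identifying it with a pushforward of the coupling gives
an equality of measures against which one can integrate. -/
lemma Minorised.eq_smul_map_add (hC : Minorised P C ε ν) {x : X} (hx : x ∈ C)
    {μ : Measure (X × X)} {p : X × X → X} (hp : Measurable p)
    (hμ : ∀ A, MeasurableSet A → μ (p ⁻¹' A) = residualMass P ε ν x A) :
    P x = ENNReal.ofReal (1 - ε) • μ.map p + ENNReal.ofReal ε • ν := by
  ext A hA
  simp [hC.eq_add hx hA, Measure.map_apply hp hA, hμ A hA]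

/-- One step of the coupling contracts oscillations, with a factor `1 - ε` on `C × C`. -/
lemma ofReal_abs_integral_sub_le (hC : Minorised P C ε ν) (hPc : IsCouplingKernel P C ε ν Pc)
    {g : X → ℝ} (hg : Measurable g) {b : ℝ} (hb : ∀ y, |g y| ≤ b) (z : X × X) :
    ENNReal.ofReal |∫ y, g y ∂P z.1 - ∫ y, g y ∂P z.2|
      ≤ step (killWeight (C ×ˢ C) (ENNReal.ofReal (1 - ε))) Pc
          (fun y ↦ ENNReal.ofReal |g y.1 - g y.2|) z := by
  have := hC.isProbabilityMeasure
  obtain ⟨x, x'⟩ := z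
  have hint : ∀ (μ : Measure X) [IsFiniteMeasure μ], Integrable g μ := fun μ _ ↦
    Integrable.of_bound hg.aestronglyMeasurable b (ae_of_all _ hb)
  have hf := hPc.fst x x'
  have hs := hPc.snd x x'
  have hi1 : Integrable (fun y : X × X ↦ g y.1) (Pc (x, x')) :=
    Integrable.of_bound (hg.comp measurable_fst).aestronglyMeasurable b (ae_of_all _ fun y ↦ hb y.1)
  have hi2 : Integrable (fun y : X × X ↦ g y.2) (Pc (x, x')) :=
    Integrable.of_bound (hg.comp measurable_snd).aestronglyMeasurable b (ae_of_all _ fun y ↦ hb y.2)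
  have hle : ENNReal.ofReal |∫ y, g y.1 ∂Pc (x, x') - ∫ y, g y.2 ∂Pc (x, x')|
      ≤ ∫⁻ y, ENNReal.ofReal |g y.1 - g y.2| ∂Pc (x, x') := by
    rw [← integral_sub hi1 hi2, ← Real.norm_eq_abs, ofReal_norm]
    refine (enorm_integral_le_lintegral_enorm _).trans_eq (lintegral_congr fun y ↦ ?_)
    rw [← Real.norm_eq_abs, ofReal_norm]
  rw [step]
  by_cases hz : (x, x') ∈ C ×ˢ C
  · simp only [hz, if_true] at hf hs
    rw [hC.eq_smul_map_add hz.1 measurable_fst (μ := Pc (x, x'))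
        (fun A hA ↦ by rw [← hf A hA, Set.prod_univ]),
      hC.eq_smul_map_add hz.2 measurable_snd (μ := Pc (x, x'))
        (fun A hA ↦ by rw [← hs A hA, Set.univ_prod]), killWeight_of_mem hz]
    have hone : ∀ p : X × X → X, Measurable p →
        ∫ y, g y ∂(ENNReal.ofReal (1 - ε) • (Pc (x, x')).map p + ENNReal.ofReal ε • ν)
          = (1 - ε) * ∫ y, g (p y) ∂Pc (x, x') + ε * ∫ y, g y ∂ν := by
      intro p hp
      rw [integral_add_measure ((hint _).smul_measure (by simp))
          ((hint _).smul_measure (by simp)), integral_smul_measure, integral_smul_measure,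
        integral_map hp.aemeasurable hg.aestronglyMeasurable,
        ENNReal.toReal_ofReal (by linarith [hC.le_one]), ENNReal.toReal_ofReal hC.pos.le]
      rfl
    -- The common term ε ν(g) cancels here, which is the source of the factor 1 - ε.
    rw [hone _ measurable_fst, hone _ measurable_snd, add_sub_add_right_eq_sub, ← mul_sub, abs_mul,
      abs_of_nonneg (by linarith [hC.le_one] : 0 ≤ 1 - ε),
      ENNReal.ofReal_mul (by linarith [hC.le_one])]
    gcongr
  · simp only [hz, if_false] at hf hs
    have h1 : P x = (Pc (x, x')).map Prod.fst := by
      ext A hA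
      rw [Measure.map_apply measurable_fst hA, ← Set.prod_univ, hf A hA]
    have h2 : P x' = (Pc (x, x')).map Prod.snd := by
      ext A hA
      rw [Measure.map_apply measurable_snd hA, ← Set.univ_prod, hs A hA]
    rw [killWeight_of_notMem hz, one_mul, h1, h2,
      integral_map measurable_fst.aemeasurable hg.aestronglyMeasurable,
      integral_map measurable_snd.aemeasurable hg.aestronglyMeasurable]
    exact hle

/-- The induction passes from g to Pg, which keeps the bound b; the one-step contraction is then
carried through n weighted steps by monotonicity. -/
lemma ofReal_abs_integral_pow_sub_le (hC : Minorised P C ε ν) (hPc : IsCouplingKernel P C ε ν Pc)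
    (n : ℕ) {g : X → ℝ} (hg : Measurable g) {b : ℝ} (hb : ∀ y, |g y| ≤ b) (z : X × X) :
    ENNReal.ofReal |∫ y, g y ∂(P ^ n) z.1 - ∫ y, g y ∂(P ^ n) z.2|
      ≤ (step (killWeight (C ×ˢ C) (ENNReal.ofReal (1 - ε))) Pc)^[n]
          (fun y ↦ ENNReal.ofReal |g y.1 - g y.2|) z := by
  induction n generalizing g with
  | zero =>
    have h (x : X) : ∫ y, g y ∂(P ^ 0) x = g x := by
      have : (P ^ 0) x = Measure.dirac x := by rw [pow_zero]; exact Kernel.id_apply x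
      rw [this, integral_dirac' _ _ hg.stronglyMeasurable]
    rw [h, h, Function.iterate_zero, id]
  | succ n ih =>
    have hm : Measurable fun y ↦ ∫ z, g z ∂P y := hg.stronglyMeasurable.integral_kernel.measurable
    have hbd : ∀ y, |∫ z, g z ∂P y| ≤ b := fun y ↦ by
      simpa using norm_integral_le_of_norm_le_const (f := g) (ae_of_all (P y) hb)
    rw [integral_pow_succ n _ hg hb, integral_pow_succ n _ hg hb, Function.iterate_succ_apply]
    exact (ih hm hbd).trans ((step_mono _ _).iterate n
      (fun y ↦ ofReal_abs_integral_sub_le hC hPc hg hb y) z)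

lemma tvDist_pow_le (hC : Minorised P C ε ν) (hPc : IsCouplingKernel P C ε ν Pc) (n : ℕ)
    (x x' : X) :
    tvDist ((P ^ n) x) ((P ^ n) x')
      ≤ (step (killWeight (C ×ˢ C) (ENNReal.ofReal (1 - ε))) Pc)^[n] (fun _ ↦ 1) (x, x') := by
  refine iSup₂_le fun A hA ↦ ?_
  have hg : Measurable (A.indicator (1 : X → ℝ)) := measurable_one.indicator hA
  have hv : ∀ y, A.indicator (1 : X → ℝ) y ∈ Set.Icc (0 : ℝ) 1 := fun y ↦ by
    by_cases hy : y ∈ A <;> simp [hy]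
  have := ofReal_abs_integral_pow_sub_le hC hPc n hg (b := 1)
    (fun y ↦ abs_le.2 ⟨by linarith [(hv y).1], (hv y).2⟩) (x, x')
  rw [integral_indicator_one hA, integral_indicator_one hA] at this
  refine this.trans ((step_mono _ _).iterate n (fun y ↦ ?_) (x, x'))
  rw [ENNReal.ofReal_le_one, abs_le]
  constructor <;> linarith [(hv y.1).1, (hv y.1).2, (hv y.2).1, (hv y.2).2]

lemma fDist_pow_le (hC : Minorised P C ε ν) (hPc : IsCouplingKernel P C ε ν Pc) (n : ℕ)
    {W : X × X → ℝ} {f : X → ℝ} (hfW : ∀ y y' : X, f y + f y' ≤ W (y, y')) (x x' : X) :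
    fDist f ((P ^ n) x) ((P ^ n) x')
      ≤ (step (killWeight (C ×ˢ C) (ENNReal.ofReal (1 - ε))) Pc)^[n]
          (fun y ↦ ENNReal.ofReal (W y)) (x, x') := by
  refine iSup₂_le fun g hg ↦ iSup₂_le fun hgf hi ↦ iSup_le fun hi' ↦ ?_
  -- The contraction is available for bounded functions only, so g is truncated at level m;
  -- dominated convergence removes the truncation.
  let G : ℕ → X → ℝ := fun m y ↦ max (-(m : ℝ)) (min (g y) m)
  have hG : ∀ m, Measurable (G m) := fun m ↦ by fun_prop
  have hGg : ∀ m y, |G m y| ≤ |g y| := by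
    intro m y
    have hm : (0 : ℝ) ≤ m := Nat.cast_nonneg m
    rcases le_total 0 (g y) with h | h
    · rw [abs_of_nonneg h, abs_le]
      exact ⟨le_max_of_le_right (by rw [le_min_iff]; constructor <;> linarith),
        max_le (by linarith) (min_le_left _ _)⟩
    · rw [abs_of_nonpos h, abs_le]
      exact ⟨le_max_of_le_right (by rw [le_min_iff]; constructor <;> linarith),
        max_le (by linarith) ((min_le_left _ _).trans (by linarith))⟩
  have hGm : ∀ m y, |G m y| ≤ m := fun m y ↦
    abs_le.2 ⟨le_max_left _ _, max_le (by linarith [(Nat.cast_nonneg m : (0 : ℝ) ≤ m)])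
      (min_le_right _ _)⟩
  have hlim : ∀ μ : Measure X, Integrable g μ →
      Filter.Tendsto (fun m ↦ ∫ y, G m y ∂μ) Filter.atTop (nhds (∫ y, g y ∂μ)) := by
    intro μ hμ
    refine tendsto_integral_of_dominated_convergence (fun y ↦ |g y|)
      (fun m ↦ (hG m).aestronglyMeasurable) hμ.abs (fun m ↦ ae_of_all _ (hGg m))
      (ae_of_all _ fun y ↦ ?_)
    refine tendsto_const_nhds.congr' ?_
    filter_upwards [Filter.eventually_ge_atTop ⌈|g y|⌉₊] with m hm
    have h := abs_le.1 (Nat.ceil_le.1 hm)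
    simp only [G]
    rw [min_eq_left h.2, max_eq_right h.1]
  refine le_of_tendsto (ENNReal.tendsto_ofReal ((hlim _ hi).sub (hlim _ hi')).abs)
    (Filter.Eventually.of_forall fun m ↦ ?_)
  refine (ofReal_abs_integral_pow_sub_le hC hPc n (hG m) (hGm m) (x, x')).trans
    ((step_mono _ _).iterate n (fun y ↦ ENNReal.ofReal_le_ofReal ?_) (x, x'))
  calc |G m y.1 - G m y.2| ≤ |G m y.1| + |G m y.2| := abs_sub _ _
    _ ≤ f y.1 + f y.2 := add_le_add ((hGg m _).trans (hgf _)) ((hGg m _).trans (hgf _))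
    _ ≤ W y := hfW _ _

end Coupling

/-! ### Submultiplicativity of subgeometric rates. -/

namespace IsSubgeometric

variable {r : ℕ → ℝ}

lemma nonneg (hr : IsSubgeometric r) (n : ℕ) : 0 ≤ r n :=
  hr.nonneg_zero.trans (hr.mono n.zero_le)

/-- A nonincreasing sequence lies above its limit, so log r(n) / n ≥ 0. -/
lemma one_le (hr : IsSubgeometric r) {n : ℕ} (hn : 1 ≤ n) : 1 ≤ r n := by
  have h : 0 ≤ Real.log (r n) / n := by
    refine le_of_tendsto hr.log_div_tendsto ?_
    filter_upwards [Filter.eventually_ge_atTop n] with k hk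
    exact hr.log_div_antitone hn (hn.trans hk) hk
  have hn' : (0 : ℝ) < n := by exact_mod_cast hn
  rw [le_div_iff₀ hn', zero_mul] at h
  exact (Real.log_nonneg_iff (hr.pos n hn)).1 h

/-- With q = log r(n + k) / (n + k), monotonicity gives nq ≤ log r(n) and kq ≤ log r(k); these add
up to the claim. -/
lemma add_le_mul (hr : IsSubgeometric r) {n k : ℕ} (hn : 1 ≤ n) (hk : 1 ≤ k) :
    r (n + k) ≤ r n * r k := by
  have hnk : 1 ≤ n + k := by lia
  have hn' : (0 : ℝ) < n := by exact_mod_cast hn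
  have hk' : (0 : ℝ) < k := by exact_mod_cast hk
  have h1 : Real.log (r (n + k)) / (n + k : ℕ) ≤ Real.log (r n) / n :=
    hr.log_div_antitone hn hnk (by lia)
  have h2 : Real.log (r (n + k)) / (n + k : ℕ) ≤ Real.log (r k) / k :=
    hr.log_div_antitone hk hnk (by lia)
  rw [← Real.log_le_log_iff (hr.pos _ hnk) (mul_pos (hr.pos _ hn) (hr.pos _ hk)),
    Real.log_mul (hr.pos _ hn).ne' (hr.pos _ hk).ne']
  rw [le_div_iff₀ hn'] at h1
  rw [le_div_iff₀ hk'] at h2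
  have h3 : Real.log (r (n + k)) = Real.log (r (n + k)) / (n + k : ℕ) * n
      + Real.log (r (n + k)) / (n + k : ℕ) * k := by
    push_cast
    field_simp
  linarith

end IsSubgeometric

/-! ### Homogeneity of weighted steps and hitting potentials. -/

section Scaling

variable {S : Type*} [MeasurableSpace S]

lemma step_iterate_const_mul (w : S → ℝ≥0∞) (K : Kernel S S) {a : ℝ≥0∞} (ha : a ≠ ∞)
    (f : S → ℝ≥0∞) (n : ℕ) :
    (step w K)^[n] (fun z ↦ a * f z) = fun z ↦ a * (step w K)^[n] f z := by
  induction n with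
  | zero => rfl
  | succ n ih =>
    ext z
    rw [Function.iterate_succ_apply', Function.iterate_succ_apply', ih, step, step,
      lintegral_const_mul' _ _ ha, mul_left_comm]

lemma hitPotential_le_mul {D : Set S} {K : Kernel S S} {u v : ℕ → S → ℝ≥0∞} {a : ℝ≥0∞}
    (ha : a ≠ ∞) {n m : ℕ} (h : ∀ k y, u (n + (k + 1)) y ≤ a * v (m + (k + 1)) y) (z : S) :
    hitPotential D K u n z ≤ a * hitPotential D K v m z := by
  rw [hitPotential, hitPotential, ← ENNReal.tsum_mul_left]
  refine ENNReal.tsum_le_tsum fun k ↦ ?_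
  have := congrFun (step_iterate_const_mul (offWeight D) K ha (v (m + (k + 1))) (k + 1)) z
  rw [← this]
  exact (step_mono _ _).iterate (k + 1) (h k) z

lemma lintegral_add_hitPotential_le_mul {D : Set S} {K : Kernel S S} {u v : ℕ → S → ℝ≥0∞}
    {a : ℝ≥0∞} (ha : a ≠ ∞) {n m : ℕ} (h : ∀ k y, u (n + k) y ≤ a * v (m + k) y) (z : S) :
    ∫⁻ y, (u n y + hitPotential D K u n y) ∂K z
      ≤ a * ∫⁻ y, (v m y + hitPotential D K v m y) ∂K z := by
  rw [← lintegral_const_mul' _ _ ha]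
  refine lintegral_mono fun y ↦ ?_
  rw [mul_add]
  exact add_le_add (h 0 y) (hitPotential_le_mul ha (fun k ↦ h (k + 1)) y)

end Scaling

/-- As τ ≥ 1, the term k = 1 is always counted. This gives r(1) ≤ R*, needed for a start in D. -/
lemma ofReal_le_supReturn {S : Type*} [MeasurableSpace S] {K : Kernel S S}
    [IsMarkovKernel K] {D : Set S} (hD : MeasurableSet D) {r : ℕ → ℝ} {z : S} (hz : z ∈ D) :
    ENNReal.ofReal (r 1) ≤ supReturn K D (fun k _ => r k) := by
  refine le_iSup₂_of_le z hz ?_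
  rw [expSumReturn_eq K z hD fun _ ↦ measurable_const]
  calc ENNReal.ofReal (r 1) = ∫⁻ _, ENNReal.ofReal (r 1) ∂K z := by simp
    _ ≤ _ := lintegral_mono fun y ↦ le_self_add

/-! ### The two summed bounds. -/

section Bounds

variable {X : Type*} [MeasurableSpace X] {P : Kernel X X} [IsMarkovKernel P]
  {C : Set X} {ε : ℝ} {ν : Measure X} {Pc : Kernel (X × X) (X × X)} [IsMarkovKernel Pc]

lemma tsum_fDist_le (hC : Minorised P C ε ν) (hPc : IsCouplingKernel P C ε ν Pc)
    {W : X × X → ℝ} (hW : Measurable W) {f : X → ℝ} (hfW : ∀ y y' : X, f y + f y' ≤ W (y, y'))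
    (x x' : X) :
    ∑' n : ℕ, fDist f ((P ^ (n + 1)) x) ((P ^ (n + 1)) x')
      ≤ expSumHit Pc (C ×ˢ C) (fun _ z => W z) (x, x')
        + ENNReal.ofReal ((1 - ε) / ε) * supReturn Pc (C ×ˢ C) (fun _ z => W z) := by
  have hD : MeasurableSet (C ×ˢ C) := hC.measurableSet.prod hC.measurableSet
  have hu : ∀ _ : ℕ, Measurable fun z ↦ ENNReal.ofReal (W z) := fun _ ↦ hW.ennreal_ofReal
  have hε := hC.pos
  have hε' : 0 ≤ 1 - ε := by linarith [hC.le_one]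
  set Ws := supReturn Pc (C ×ˢ C) (fun _ z => W z) with hWs
  -- With t = (1 - ε)/ε, this is the fixed-point equation (1 - ε)(t + 1) = t.
  have hq : ENNReal.ofReal (1 - ε) * (ENNReal.ofReal ((1 - ε) / ε) + 1)
      = ENNReal.ofReal ((1 - ε) / ε) := by
    rw [← ENNReal.ofReal_one, ← ENNReal.ofReal_add (by positivity) zero_le_one,
      ← ENNReal.ofReal_mul hε']
    congr 1
    field_simp
    ring
  refine ENNReal.tsum_le_of_sum_range_le fun N ↦ ?_
  refine (Finset.sum_le_sum fun n _ ↦ fDist_pow_le hC hPc (n + 1) hfW x x').trans ?_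
  refine (sum_step_le_hitPotential_add (u := fun _ z ↦ ENNReal.ofReal (W z))
    (u' := fun _ z ↦ ENNReal.ofReal (W z)) (n₀ := 0)
    (c := fun _ ↦ ENNReal.ofReal ((1 - ε) / ε) * Ws) hD hu hu (fun _ _ _ ↦ le_rfl) ?_ N 0 le_rfl
    (x, x')).trans ?_
  · intro n _ z hz
    have hret : ∫⁻ y, (ENNReal.ofReal (W y)
        + hitPotential (C ×ˢ C) Pc (fun _ z ↦ ENNReal.ofReal (W z)) (n + 1) y) ∂Pc z ≤ Ws := by
      refine le_trans (le_of_eq ?_) (le_iSup₂_of_le z hz le_rfl)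
      exact (expSumReturn_eq Pc z hD (fun _ ↦ hW)).symm
    calc _ ≤ ENNReal.ofReal (1 - ε) * (ENNReal.ofReal ((1 - ε) / ε) * Ws + Ws) := by gcongr
      _ = ENNReal.ofReal (1 - ε) * (ENNReal.ofReal ((1 - ε) / ε) + 1) * Ws := by ring
      _ = _ := by rw [hq]
  · rw [expSumHit_eq Pc _ hD (fun _ ↦ hW)]
    gcongr
    exact le_add_self

/-- Bound on the rate-weighted total variation distances, from constants `β` and `b` that satisfy
the drift inequalities on `C × C`. -/
lemma tsum_tvDist_le_of_drift (hC : Minorised P C ε ν) (hPc : IsCouplingKernel P C ε ν Pc)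
    {r : ℕ → ℝ} (hr : IsSubgeometric r) {β δ : ℝ} (hβ : 0 ≤ β) (hβδ : β ≤ δ) {b B : ℝ≥0∞}
    (hbB : b ≤ B) {x x' : X}
    (hdrift : ∀ n ≥ 1, ENNReal.ofReal (1 - ε)
      * (ENNReal.ofReal (β * ∑ k ∈ Finset.range (n + 1), r k) + b
        + ENNReal.ofReal ((1 + β) * r n) * supReturn Pc (C ×ˢ C) (fun k _ => r k))
      ≤ ENNReal.ofReal (β * ∑ k ∈ Finset.range (n + 1), r k) + b)
    (hstart : (x, x') ∈ C ×ˢ C → ENNReal.ofReal (1 - ε)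
      * (ENNReal.ofReal (β * r 0) + b
        + ENNReal.ofReal (1 + β) * supReturn Pc (C ×ˢ C) (fun k _ => r k))
      ≤ ENNReal.ofReal ((1 + δ) * r 0) + B) :
    ∑' n : ℕ, ENNReal.ofReal (r (n + 1)) * tvDist ((P ^ (n + 1)) x) ((P ^ (n + 1)) x')
      ≤ ENNReal.ofReal (1 + δ) * expSumHit Pc (C ×ˢ C) (fun k _ => r k) (x, x') + B := by
  have hD : MeasurableSet (C ×ˢ C) := hC.measurableSet.prod hC.measurableSet
  have hsum : ∀ n, 0 ≤ ∑ k ∈ Finset.range n, r k := fun n ↦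
    Finset.sum_nonneg fun k _ ↦ hr.nonneg k
  let w := killWeight (C ×ˢ C) (ENNReal.ofReal (1 - ε))
  let u : ℕ → X × X → ℝ≥0∞ := fun n _ ↦ ENNReal.ofReal (r n)
  let u' : ℕ → X × X → ℝ≥0∞ := fun n _ ↦ ENNReal.ofReal ((1 + β) * r n)
  -- The increment c(n + 1) - c(n) is β r(n + 1), exactly the excess of `u'` over `u`, so the
  -- condition `hoff` is an equality.
  let c : ℕ → ℝ≥0∞ := fun n ↦ ENNReal.ofReal (β * ∑ k ∈ Finset.range (n + 1), r k) + b
  have hu : ∀ n, Measurable (u n) := fun _ ↦ measurable_const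
  have hu' : ∀ n, Measurable (u' n) := fun _ ↦ measurable_const
  have hoff : ∀ n y, u (n + 1) y + c (n + 1) ≤ u' (n + 1) y + c n := by
    intro n y
    simp only [u, u', c]
    rw [← add_assoc, ← add_assoc, ← ENNReal.ofReal_add (hr.nonneg _) (mul_nonneg hβ (hsum _)),
      ← ENNReal.ofReal_add (mul_nonneg (by linarith) (hr.nonneg _)) (mul_nonneg hβ (hsum _)),
      Finset.sum_range_succ _ (n + 1)]
    refine (le_of_eq ?_)
    congr 2
    ring
  have hret : ∀ z ∈ C ×ˢ C, ∫⁻ y, (u 1 y + hitPotential (C ×ˢ C) Pc u 1 y) ∂Pc z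
      ≤ supReturn Pc (C ×ˢ C) (fun k _ => r k) := fun z hz ↦
    le_iSup₂_of_le z hz (expSumReturn_eq Pc z hD fun _ ↦ measurable_const).ge
  have hret_succ : ∀ n ≥ 1, ∀ z ∈ C ×ˢ C,
      ∫⁻ y, (u' (n + 1) y + hitPotential (C ×ˢ C) Pc u' (n + 1) y) ∂Pc z
        ≤ ENNReal.ofReal ((1 + β) * r n) * supReturn Pc (C ×ˢ C) (fun k _ => r k) := by
    intro n hn z hz
    refine (lintegral_add_hitPotential_le_mul (v := u) (m := 1) ENNReal.ofReal_ne_top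
      (fun k y ↦ ?_) z).trans (mul_le_mul_right (hret z hz) _)
    simp only [u, u']
    rw [← ENNReal.ofReal_mul (mul_nonneg (by linarith) (hr.nonneg _)), mul_assoc, add_assoc]
    exact ENNReal.ofReal_le_ofReal
      (mul_le_mul_of_nonneg_left (hr.add_le_mul hn (by lia)) (by linarith))
  have hpot : ∀ N, ∀ n ≥ 1, ∀ z,
      ∑ k ∈ Finset.range N, (step w Pc)^[k + 1] (u (n + (k + 1))) z
        ≤ hitPotential (C ×ˢ C) Pc u' n z + c n := by
    refine fun N ↦ sum_step_le_hitPotential_add hD hu hu' (fun n _ ↦ hoff n) ?_ N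
    intro n hn z hz
    refine le_trans ?_ (hdrift n hn)
    gcongr
    exact hret_succ n hn z hz
  have hu'u : ∀ n y, u' n y ≤ ENNReal.ofReal (1 + β) * u n y := fun n y ↦ by
    simp only [u, u']
    rw [ENNReal.ofReal_mul (by linarith)]
  -- At time 0 the bound r(0 + k) ≤ r(0) r(k) may fail. One step is therefore made by hand, and the
  -- drift bound is used from time 1 on.
  have hmain : ∀ N, ∑ k ∈ Finset.range (N + 1), (step w Pc)^[k + 1] (u (0 + (k + 1))) (x, x')
      ≤ ENNReal.ofReal (1 + δ) * expSumHit Pc (C ×ˢ C) (fun k _ => r k) (x, x') + B := by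
    intro N
    refine (sum_step_succ_le hD hu (hoff 0) (hpot N 1 le_rfl) (x, x')).trans ?_
    rw [expSumHit_eq Pc _ hD fun _ ↦ measurable_const]
    change _ ≤ ENNReal.ofReal (1 + δ)
      * (ENNReal.ofReal (r 0) + hitPotential (C ×ˢ C) Pc u 0 (x, x')) + B
    rw [mul_add (ENNReal.ofReal (1 + δ)), ← ENNReal.ofReal_mul (by linarith)]
    by_cases hz : (x, x') ∈ C ×ˢ C
    · rw [killWeight_of_mem hz]
      calc _ ≤ ENNReal.ofReal (1 - ε) * (ENNReal.ofReal (β * r 0) + b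
            + ENNReal.ofReal (1 + β) * supReturn Pc (C ×ˢ C) (fun k _ => r k)) := by
            simp only [c, zero_add, Finset.sum_range_one]
            gcongr
            exact (lintegral_add_hitPotential_le_mul (v := u) (m := 1) ENNReal.ofReal_ne_top
              (fun k y ↦ hu'u _ y) (x, x')).trans (mul_le_mul_right (hret _ hz) _)
        _ ≤ _ := hstart hz
        _ ≤ _ := by gcongr; exact le_self_add
    · have h := congrFun (hitPotential_eq_step Pc hD hu' 0) (x, x')
      rw [step, offWeight_of_notMem hz] at h
      rw [killWeight_of_notMem hz, mul_add, ← h, one_mul, add_comm]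
      simp only [c, zero_add, Finset.sum_range_one]
      calc _ ≤ ENNReal.ofReal (1 + β) * hitPotential (C ×ˢ C) Pc u 0 (x, x')
            + (ENNReal.ofReal (β * r 0) + b) := by
            gcongr
            exact hitPotential_le_mul ENNReal.ofReal_ne_top (fun k y ↦ hu'u _ y) _
        _ ≤ ENNReal.ofReal (1 + δ) * hitPotential (C ×ˢ C) Pc u 0 (x, x')
            + (ENNReal.ofReal ((1 + δ) * r 0) + B) := by
            gcongr
            · exact hr.nonneg 0
            · linarith
        _ = _ := by ring
  refine ENNReal.tsum_le_of_sum_range_le fun N ↦ ?_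
  refine le_trans ?_ (hmain N)
  refine le_trans ?_ (Finset.sum_le_sum_of_subset (Finset.range_mono N.le_succ))
  refine Finset.sum_le_sum fun n _ ↦ ?_
  have h := congrFun (step_iterate_const_mul w Pc (a := ENNReal.ofReal (r (n + 1)))
    ENNReal.ofReal_ne_top (fun _ ↦ 1) (n + 1)) (x, x')
  calc _ ≤ ENNReal.ofReal (r (n + 1)) * (step w Pc)^[n + 1] (fun _ ↦ 1) (x, x') := by
        gcongr
        exact tvDist_pow_le hC hPc (n + 1) x x'
    _ = _ := by rw [← h]; simp [u]

/-- The smallest slope for which the drift inequalities hold with the constant `rateConst`. -/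
noncomputable def driftSlope (ε δ : ℝ) : ℝ := (1 - ε) ^ 2 * δ / (1 + δ - (1 - ε) ^ 2 * δ)

/-! ### Algebra of the slope β and the drift inequalities. -/

section DriftSlope

variable {δ : ℝ}

lemma driftSlope_denom_pos (h0 : 0 < ε) (h1 : ε ≤ 1) (hδ : 0 < δ) :
    0 < 1 + δ - (1 - ε) ^ 2 * δ := by
  have : (1 - ε) ^ 2 ≤ 1 := by nlinarith
  nlinarith

lemma driftSlope_nonneg (h0 : 0 < ε) (h1 : ε ≤ 1) (hδ : 0 < δ) : 0 ≤ driftSlope ε δ :=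
  div_nonneg (by positivity) (driftSlope_denom_pos h0 h1 hδ).le

lemma sub_driftSlope (h0 : 0 < ε) (h1 : ε ≤ 1) (hδ : 0 < δ) :
    δ - driftSlope ε δ = δ * (ε * (2 - ε)) * (1 + δ) / (1 + δ - (1 - ε) ^ 2 * δ) := by
  have := (driftSlope_denom_pos h0 h1 hδ).ne'
  rw [driftSlope, eq_div_iff this, sub_mul, div_mul_cancel₀ _ this]
  ring

lemma driftSlope_le (h0 : 0 < ε) (h1 : ε ≤ 1) (hδ : 0 < δ) : driftSlope ε δ ≤ δ := by
  rw [← sub_nonneg, sub_driftSlope h0 h1 hδ]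
  have h2 : 0 ≤ 2 - ε := by linarith
  exact div_nonneg (by positivity) (driftSlope_denom_pos h0 h1 hδ).le

/-- The equation that determines β, equivalent for ε < 1 to β / (1 + β) = (1 - ε)² δ / (1 + δ): it
matches the growth of c(n) with the term subtracted in M. -/
lemma mul_driftSlope (h0 : 0 < ε) (h1 : ε ≤ 1) (hδ : 0 < δ) :
    ε * driftSlope ε δ = (1 - ε) * (1 + driftSlope ε δ) * (ε * (1 - ε) * δ / (1 + δ)) := by
  have := (driftSlope_denom_pos h0 h1 hδ).ne'
  have : 1 + δ ≠ 0 := by positivity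
  rw [driftSlope]
  field_simp
  ring

/-- Replacing 1 + β by 1 + δ in front of m leaves slack; this slack covers the extra ε β that a
start in D costs. -/
lemma mul_driftSlope_le (h0 : 0 < ε) (h1 : ε ≤ 1) (hδ : 0 < δ) {m : ℝ} (hm : 1 / 2 ≤ m) :
    ε * driftSlope ε δ ≤ (1 - ε) / ε * (δ - driftSlope ε δ) * m := by
  have hd := driftSlope_denom_pos h0 h1 hδ
  have h2 : 0 ≤ 1 - ε := by linarith
  have h3 : (1 - ε) / ε * (δ - driftSlope ε δ) * m
      = (1 - ε) * δ * ((2 - ε) * (1 + δ) * m) / (1 + δ - (1 - ε) ^ 2 * δ) := by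
    rw [sub_driftSlope h0 h1 hδ]
    field_simp
  have h4 : ε * driftSlope ε δ
      = (1 - ε) * δ * (ε * (1 - ε)) / (1 + δ - (1 - ε) ^ 2 * δ) := by
    rw [driftSlope]
    ring
  rw [h3, h4]
  refine div_le_div_of_nonneg_right (mul_le_mul_of_nonneg_left ?_ (by positivity)) hd.le
  have h5 : ε * (1 - ε) ≤ 1 / 4 := by nlinarith [sq_nonneg (ε - 1 / 2)]
  have h6 : 1 * 1 ≤ (2 - ε) * (1 + δ) := mul_le_mul (by linarith) (by linarith) zero_le_one
    (by linarith)
  nlinarith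

end DriftSlope

lemma drift_ineq {ε δ : ℝ} (h0 : 0 < ε) (h1 : ε ≤ 1) (hδ : 0 < δ) {R ρ a m : ℝ}
    (hm : ρ * a - ε * (1 - ε) * δ * R / (1 + δ) ≤ m) :
    (1 - ε) * (driftSlope ε δ * R + (1 - ε) / ε * ((1 + driftSlope ε δ) * m)
        + (1 + driftSlope ε δ) * a * ρ)
      ≤ driftSlope ε δ * R + (1 - ε) / ε * ((1 + driftSlope ε δ) * m) := by
  have hβ := driftSlope_nonneg h0 h1 hδ
  have hs := mul_driftSlope h0 h1 hδ
  set β := driftSlope ε δ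
  have h2 : ε * ((1 - ε) / ε * ((1 + β) * m)) = (1 - ε) * (1 + β) * m := by
    field_simp
  have h3 : (1 - ε) * (1 + β) * (ρ * a)
      ≤ (1 - ε) * (1 + β) * (m + ε * (1 - ε) * δ / (1 + δ) * R) := by
    refine mul_le_mul_of_nonneg_left ?_ (mul_nonneg (by linarith) (by linarith))
    rw [div_mul_eq_mul_div]
    linarith
  have h4 : (1 - ε) * (1 + β) * (m + ε * (1 - ε) * δ / (1 + δ) * R)
      = (1 - ε) * (1 + β) * m + ε * β * R := by rw [hs]; ring
  linarith

lemma drift_ineq_start {ε δ : ℝ} (h0 : 0 < ε) (h1 : ε ≤ 1) (hδ : 0 < δ) {r₀ r₁ ρ m : ℝ}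
    (hr₀ : 0 ≤ r₀) (hr₀₁ : r₀ ≤ r₁) (hr₁ : 1 ≤ r₁) (hρ : r₁ ≤ ρ)
    (hm : ρ * r₁ - ε * (1 - ε) * δ * (r₀ + r₁) / (1 + δ) ≤ m) :
    (1 - ε) * (driftSlope ε δ * r₀ + (1 - ε) / ε * ((1 + driftSlope ε δ) * m)
        + (1 + driftSlope ε δ) * ρ)
      ≤ (1 + δ) * r₀ + (1 - ε) / ε * ((1 + δ) * m) := by
  have hc : ε * (1 - ε) * δ / (1 + δ) ≤ 1 / 4 := by
    rw [div_le_iff₀ (by positivity)]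
    have h5 : ε * (1 - ε) ≤ 1 / 4 := by nlinarith [sq_nonneg (ε - 1 / 2)]
    nlinarith
  have hs := mul_driftSlope h0 h1 hδ
  have hc0 : 0 ≤ ε * (1 - ε) * δ / (1 + δ) :=
    div_nonneg (mul_nonneg (mul_nonneg h0.le (by linarith)) hδ.le) (by positivity)
  rw [mul_div_right_comm] at hm
  set c := ε * (1 - ε) * δ / (1 + δ)
  -- Since ρ ≥ r₁ ≥ r₀ and c ≤ 1/4, m is at least r₁² - r₁/2, and r₁ ≥ 1.
  have hm2 : 1 / 2 ≤ m := by nlinarith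
  -- The hypothesis reads (ρ - c) r₁ ≤ m + c r₀, where ρ ≥ c and r₁ ≥ 1.
  have hρm : ρ ≤ m + c * (r₀ + 1) := by nlinarith
  have hβ := driftSlope_nonneg h0 h1 hδ
  have hβδ := driftSlope_le h0 h1 hδ
  have hlast := mul_driftSlope_le h0 h1 hδ hm2
  set β := driftSlope ε δ
  have h2 : ε * ((1 - ε) / ε * ((1 + β) * m)) = (1 - ε) * (1 + β) * m := by
    field_simp
  have h3 : (1 - ε) * (1 + β) * ρ ≤ (1 - ε) * (1 + β) * (m + c * (r₀ + 1)) :=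
    mul_le_mul_of_nonneg_left hρm (mul_nonneg (by linarith) (by linarith))
  have h4 : (1 - ε) * (1 + β) * (m + c * (r₀ + 1))
      = (1 - ε) * (1 + β) * m + ε * β * (r₀ + 1) := by rw [hs]; ring
  have h5 : β * r₀ ≤ (1 + δ) * r₀ := mul_le_mul_of_nonneg_right (by linarith) hr₀
  linarith

lemma tsum_tvDist_le (hC : Minorised P C ε ν) (hPc : IsCouplingKernel P C ε ν Pc)
    {r : ℕ → ℝ} (hr : IsSubgeometric r) {δ : ℝ} (hδ : 0 < δ) (x x' : X) :
    ∑' n : ℕ, ENNReal.ofReal (r (n + 1)) * tvDist ((P ^ (n + 1)) x) ((P ^ (n + 1)) x')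
      ≤ ENNReal.ofReal (1 + δ) * expSumHit Pc (C ×ˢ C) (fun k _ => r k) (x, x')
        + ENNReal.ofReal ((1 - ε) / ε)
          * rateConst r ε δ (supReturn Pc (C ×ˢ C) (fun k _ => r k)) := by
  have h0 := hC.pos
  have h1 := hC.le_one
  rcases h1.eq_or_lt with rfl | hlt
  -- For ε = 1 the weight vanishes on D, so β = b = 0 works; the last term of the bound is 0 even if
  -- `rateConst` is infinite.
  · exact tsum_tvDist_le_of_drift hC hPc hr le_rfl hδ.le (b := 0) zero_le
      (by simp) (by simp)
  have hq : 0 < (1 - ε) / ε := div_pos (by linarith) h0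
  set Rs := supReturn Pc (C ×ˢ C) (fun k _ => r k) with hRs
  have hβ := driftSlope_nonneg h0 h1 hδ
  have hβδ := driftSlope_le h0 h1 hδ
  set sup : ℝ≥0∞ := ⨆ n : ℕ, (Rs * ENNReal.ofReal (r n)
      - ENNReal.ofReal (ε * (1 - ε) * δ * (∑ k ∈ Finset.range (n + 1), r k) / (1 + δ))) with hsup
  have hM : rateConst r ε δ Rs = ENNReal.ofReal (1 + δ) * sup := rfl
  rw [hM]
  by_cases hsup_top : sup = ∞
  · rw [hsup_top, ENNReal.mul_top (by simp; linarith), ENNReal.mul_top (by simpa using hq)]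
    simp
  have hle : ∀ n, Rs * ENNReal.ofReal (r n)
      ≤ sup + ENNReal.ofReal
        (ε * (1 - ε) * δ * (∑ k ∈ Finset.range (n + 1), r k) / (1 + δ)) := fun n ↦
    tsub_le_iff_right.1 (le_iSup (fun n : ℕ ↦ Rs * ENNReal.ofReal (r n)
      - ENNReal.ofReal (ε * (1 - ε) * δ * (∑ k ∈ Finset.range (n + 1), r k) / (1 + δ))) n)
  have hRs_top : Rs ≠ ∞ := by
    intro htop
    -- Index 1 rather than 0, because r(0) may vanish.
    have := hle 1
    rw [htop, ENNReal.top_mul (by simpa using hr.pos 1 le_rfl), top_le_iff,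
      ENNReal.add_eq_top] at this
    exact this.elim hsup_top ENNReal.ofReal_ne_top
  obtain ⟨m, hm0, hm⟩ : ∃ m : ℝ, 0 ≤ m ∧ sup = ENNReal.ofReal m :=
    ⟨sup.toReal, ENNReal.toReal_nonneg, (ENNReal.ofReal_toReal hsup_top).symm⟩
  obtain ⟨ρ, hρ0, hρ⟩ : ∃ ρ : ℝ, 0 ≤ ρ ∧ Rs = ENNReal.ofReal ρ :=
    ⟨Rs.toReal, ENNReal.toReal_nonneg, (ENNReal.ofReal_toReal hRs_top).symm⟩
  have hsum : ∀ n, 0 ≤ ∑ k ∈ Finset.range n, r k := fun n ↦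
    Finset.sum_nonneg fun k _ ↦ hr.nonneg k
  have hle' : ∀ n, ρ * r n
      - ε * (1 - ε) * δ * (∑ k ∈ Finset.range (n + 1), r k) / (1 + δ) ≤ m := by
    intro n
    have hcn : 0 ≤ ε * (1 - ε) * δ * (∑ k ∈ Finset.range (n + 1), r k) / (1 + δ) :=
      div_nonneg (mul_nonneg (mul_nonneg (mul_nonneg h0.le (by linarith)) hδ.le) (hsum _))
        (by linarith)
    have := hle n
    rw [hρ, hm, ← ENNReal.ofReal_mul hρ0, ← ENNReal.ofReal_add hm0 hcn,
      ENNReal.ofReal_le_ofReal_iff (by positivity)] at this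
    linarith
  have hδm : ENNReal.ofReal ((1 - ε) / ε) * (ENNReal.ofReal (1 + δ) * sup)
      = ENNReal.ofReal ((1 - ε) / ε * ((1 + δ) * m)) := by
    rw [hm, ← ENNReal.ofReal_mul (by linarith), ← ENNReal.ofReal_mul hq.le]
  have hb0 : 0 ≤ (1 - ε) / ε * ((1 + driftSlope ε δ) * m) := by positivity
  refine tsum_tvDist_le_of_drift hC hPc hr hβ hβδ
    (b := ENNReal.ofReal ((1 - ε) / ε * ((1 + driftSlope ε δ) * m))) ?_ (fun n hn ↦ ?_)
    (fun hz ↦ ?_)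
  · rw [hδm]
    gcongr
  · have hn0 := hr.nonneg n
    have hβs := mul_nonneg hβ (hsum (n + 1))
    rw [← hRs, hρ, ← ENNReal.ofReal_mul (by positivity), ← ENNReal.ofReal_add hβs hb0,
      ← ENNReal.ofReal_add (by positivity) (by positivity), ← ENNReal.ofReal_mul (by linarith)]
    exact ENNReal.ofReal_le_ofReal (drift_ineq h0 h1 hδ (hle' n))
  · have hr0 := hr.nonneg_zero
    have hr1 : r 1 ≤ ρ := by
      have := ofReal_le_supReturn (K := Pc)
        (hC.measurableSet.prod hC.measurableSet) (r := r) hz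
      rwa [← hRs, hρ, ENNReal.ofReal_le_ofReal_iff hρ0] at this
    -- Index 1 of the supremum is the term R* r(1) minus a multiple of R(2) = r(0) + r(1); it
    -- controls R* itself, whereas index 0 gives nothing when r(0) = 0.
    have h := hle' 1
    rw [Finset.sum_range_succ, Finset.sum_range_one] at h
    rw [hδm, ← hRs, hρ, ← ENNReal.ofReal_mul (by positivity),
      ← ENNReal.ofReal_add (by positivity) hb0,
      ← ENNReal.ofReal_add (by positivity) (by positivity), ← ENNReal.ofReal_mul (by linarith),
      ← ENNReal.ofReal_add (by positivity) (by positivity)]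
    exact ENNReal.ofReal_le_ofReal
      (drift_ineq_start h0 h1 hδ hr0 (hr.mono zero_le_one) (hr.one_le le_rfl) hr1 h)

end Bounds

end SubgeometricCoupling

open SubgeometricCoupling in
theorem theorem1 {X : Type*} [MeasurableSpace X]
    (P : Kernel X X) [IsMarkovKernel P]
    (C : Set X) (ε : ℝ) (ν : Measure X) (hC : Minorised P C ε ν)
    (Pc : Kernel (X × X) (X × X)) [IsMarkovKernel Pc] (hPc : IsCouplingKernel P C ε ν Pc) :
    (∀ r : ℕ → ℝ, IsSubgeometric r → ∀ δ : ℝ, 0 < δ → ∀ x x' : X,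
      ∑' n : ℕ, ENNReal.ofReal (r (n + 1)) * tvDist ((P ^ (n + 1)) x) ((P ^ (n + 1)) x')
        ≤ ENNReal.ofReal (1 + δ) * expSumHit Pc (C ×ˢ C) (fun k _ => r k) (x, x')
          + ENNReal.ofReal ((1 - ε) / ε)
            * rateConst r ε δ (supReturn Pc (C ×ˢ C) (fun k _ => r k))) ∧
    (∀ W : X × X → ℝ, Measurable W → (∀ z, 1 ≤ W z) →
      ∀ f : X → ℝ, (∀ y, 0 ≤ f y) → (∀ y y' : X, f y + f y' ≤ W (y, y')) → ∀ x x' : X,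
      ∑' n : ℕ, fDist f ((P ^ (n + 1)) x) ((P ^ (n + 1)) x')
        ≤ expSumHit Pc (C ×ˢ C) (fun _ z => W z) (x, x')
          + ENNReal.ofReal ((1 - ε) / ε) * supReturn Pc (C ×ˢ C) (fun _ z => W z)) := by
  exact ⟨fun r hr δ hδ x x' ↦ tsum_tvDist_le hC hPc hr hδ x x',
    fun W hW _ f _ hfW x x' ↦ tsum_fDist_le hC hPc hW hfW x x'⟩
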